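/- **Theorem 3.** Consider the following online envy minimization problem with two players. Let $D_1, D_2$ be probability distributions on $[0,1]$ and let $n$ items have values $v^i_j\sim D_i$ ($i\in\{1,2\}$, $1\le j\le n$), all $2n$ values being independent. The algorithm knows $n$ and may evaluate $D_i((-\infty,x])$ and $D_i((-\infty,x))$ for real numbers $x$. The items arrive one by one; when item $j$ arrives, its values $v^1_j, v^2_j$ are revealed and the item must be given immediately and irrevocably to one of the two players. If $S$ is the set of items given to the first player and $\overline S$ the set of items given to the second one, the envy is $$\mathsf{envy}=\max\Big\{\sum_{j\in\overline S}v^1_j-\sum_{j\in S}v^1_j,\ \sum_{j\in S}v^2_j-\sum_{j\in\overline S}v^2_j\Big\}.$$ There is a single (randomized) online algorithm, independent of $n$, $D_1$ and $D_2$, with the following two properties. 1. It is efficient: there is a polynomial $p$ such that for all $n$, $D_1$, $D_2$, all sequences of item values and all outcomes of its random choices, it allocates the $n$ items in at most $p(n)$ steps in total. Here the algorithm is a program for a unit-cost real RAM (natural number and real memory with indirect addressing; addition, truncated subtraction and comparison of natural numbers; conversion of natural numbers to reals; $+,-,\times,/$ and comparison of reals; no rounding) that can also draw independent uniformly random reals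 from $[0,1]$ and query the values $D_i((-\infty,x])$ and $D_i((-\infty,x))$. 2. Its envy is $O(n^{c/\log\log n})$ with high probability: for every $k\in\mathbb N$ there are constants $c, C$, depending only on $k$, such that for all $n\ge 3$ and all $D_1, D_2$, $$\Pr\big[\mathsf{envy}> C\,n^{c/\log\log n}\big]\le n^{-k},$$ where the probability is over the item values and the random choices of the algorithm. -/

import Mathlib

/-!
# Randomized real-RAM programs and the online envy minimization problem

Computation is modelled by structured programs for a unit-cost real RAM: a memory of natural
numbers and a memory of real numbers, both with indirect addressing, exact field operations and
comparisons on reals, addition, truncated subtraction and comparisons on naturals, an instruction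
that draws a uniformly distributed real from `[0,1]`, and queries to the distributions that are
part of the problem instance. There is no rounding or floor operation.
-/

open MeasureTheory

namespace RealRAM

/-- Contents of the two memories, together with the number of random reals drawn so far. -/
structure State where
  nats : ℕ → ℕ
  reals : ℕ → ℝ
  draws : ℕ

/-- Expressions with natural number values; `cell e` reads the natural number at address `e`. -/
inductive NatExpr where
  | lit (k : ℕ)
  | cell (e : NatExpr)
  | add (e₁ e₂ : NatExpr)
  | sub (e₁ e₂ : NatExpr)

/-- Expressions with real values; `cell e` reads the real number at address `e`, and
`massLe i e`, `massLt i e` query the `i`-th distribution. -/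
inductive RealExpr where
  | ofNat (e : NatExpr)
  | cell (e : NatExpr)
  | add (e₁ e₂ : RealExpr)
  | sub (e₁ e₂ : RealExpr)
  | mul (e₁ e₂ : RealExpr)
  | div (e₁ e₂ : RealExpr)
  | massLe (i : Fin 2) (e : RealExpr)
  | massLt (i : Fin 2) (e : RealExpr)

/-- Tests. -/
inductive Test where
  | natLe (e₁ e₂ : NatExpr)
  | realLe (e₁ e₂ : RealExpr)
  | not (b : Test)
  | and (b₁ b₂ : Test)

/-- Programs. `setNat a e` and `setReal a e` store the value of `e` at address `a`, `draw a` stores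
a fresh random real at address `a`, and `loop b c` repeats `c` as long as `b` holds. -/
inductive Program where
  | skip
  | setNat (a e : NatExpr)
  | setReal (a : NatExpr) (e : RealExpr)
  | draw (a : NatExpr)
  | seq (c₁ c₂ : Program)
  | ite (b : Test) (c₁ c₂ : Program)
  | loop (b : Test) (c : Program)

def NatExpr.eval (s : State) : NatExpr → ℕ
  | lit k => k
  | cell e => s.nats (e.eval s)
  | add e₁ e₂ => e₁.eval s + e₂.eval s
  | sub e₁ e₂ => e₁.eval s - e₂.eval s

/-- A query `massLe i e` returns the mass of `(-∞, x]`, and `massLt i e` the mass of `(-∞, x)`,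
under the `i`-th distribution, where `x` is the value of `e`. -/
noncomputable def RealExpr.eval (D : Fin 2 → Measure ℝ) (s : State) : RealExpr → ℝ
  | ofNat e => (e.eval s : ℝ)
  | cell e => s.reals (e.eval s)
  | add e₁ e₂ => e₁.eval D s + e₂.eval D s
  | sub e₁ e₂ => e₁.eval D s - e₂.eval D s
  | mul e₁ e₂ => e₁.eval D s * e₂.eval D s
  | div e₁ e₂ => e₁.eval D s / e₂.eval D s
  | massLe i e => (D i).real (Set.Iic (e.eval D s))
  | massLt i e => (D i).real (Set.Iio (e.eval D s))

def Test.Holds (D : Fin 2 → Measure ℝ) (s : State) : Test → Prop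
  | natLe e₁ e₂ => e₁.eval s ≤ e₂.eval s
  | realLe e₁ e₂ => e₁.eval D s ≤ e₂.eval D s
  | not b => ¬ b.Holds D s
  | and b₁ b₂ => b₁.Holds D s ∧ b₂.Holds D s

/-- `Exec D ω c s t s'`: started in the state `s`, the program `c` halts after `t` steps in the
state `s'`, where `D` answers the queries and `ω` is the sequence of random reals. Every basic
command and every test counts as one step; since a program contains finitely many expressions,
charging for each operation inside them would change `t` at most by a factor that depends
on the program only. -/
inductive Exec (D : Fin 2 → Measure ℝ) (ω : ℕ → unitInterval) :
    Program → State → ℕ → State → Prop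
  | skip (s : State) : Exec D ω .skip s 1 s
  | setNat (a e : NatExpr) (s : State) :
      Exec D ω (.setNat a e) s 1
        { s with nats := Function.update s.nats (a.eval s) (e.eval s) }
  | setReal (a : NatExpr) (e : RealExpr) (s : State) :
      Exec D ω (.setReal a e) s 1
        { s with reals := Function.update s.reals (a.eval s) (e.eval D s) }
  | draw (a : NatExpr) (s : State) :
      Exec D ω (.draw a) s 1
        { s with
          reals := Function.update s.reals (a.eval s) (ω s.draws : ℝ)
          draws := s.draws + 1 }
  | seq {c₁ c₂ : Program} {s s' s'' : State} {t₁ t₂ : ℕ}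
      (h₁ : Exec D ω c₁ s t₁ s') (h₂ : Exec D ω c₂ s' t₂ s'') :
      Exec D ω (.seq c₁ c₂) s (t₁ + t₂) s''
  | ite_true {b : Test} {c₁ c₂ : Program} {s s' : State} {t : ℕ}
      (hb : b.Holds D s) (h : Exec D ω c₁ s t s') :
      Exec D ω (.ite b c₁ c₂) s (t + 1) s'
  | ite_false {b : Test} {c₁ c₂ : Program} {s s' : State} {t : ℕ}
      (hb : ¬ b.Holds D s) (h : Exec D ω c₂ s t s') :
      Exec D ω (.ite b c₁ c₂) s (t + 1) s'
  | loop_done {b : Test} {c : Program} {s : State} (hb : ¬ b.Holds D s) :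
      Exec D ω (.loop b c) s 1 s
  | loop_next {b : Test} {c : Program} {s s' s'' : State} {t₁ t₂ : ℕ}
      (hb : b.Holds D s) (h₁ : Exec D ω c s t₁ s') (h₂ : Exec D ω (.loop b c) s' t₂ s'') :
      Exec D ω (.loop b c) s (t₁ + t₂ + 1) s''

end RealRAM

namespace OnlineEnvy

open RealRAM

/-- An online allocation algorithm: one program that is run before the first item arrives, and one
that is run on the arrival of every item. The memory is kept between these runs. -/
structure Algorithm where
  setup : Program
  round : Program

/-- At the beginning all memory cells are zero, except that the number `n` of items is stored in
cell `0` of the natural number memory. -/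
def startState (n : ℕ) : State where
  nats := fun a => if a = 0 then n else 0
  reals := fun _ => 0
  draws := 0

/-- The arrival of an item: its values for the first and for the second player are written
to the cells `0` and `1` of the real memory. -/
noncomputable def present (s : State) (x : Fin 2 → ℝ) : State :=
  { s with reals := Function.update (Function.update s.reals 0 (x 0)) 1 (x 1) }

/-- `A.Reaches D ω v j s S t`: after `j` of the `n` items, where item `i` has the value `v i p` for
player `p`, the algorithm is in the state `s`, has used `t` steps in total, and has given the items
of `S` to the first player and the other ones of the first `j` items to the second player. The
item that has just arrived goes to the first player if and only if the round leaves a nonzero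
number in cell `1` of the natural number memory. -/
inductive Algorithm.Reaches (A : Algorithm) (D : Fin 2 → Measure ℝ) (ω : ℕ → unitInterval)
    {n : ℕ} (v : Fin n → Fin 2 → ℝ) : ℕ → State → Finset (Fin n) → ℕ → Prop
  | start {s : State} {t : ℕ} (h : Exec D ω A.setup (startState n) t s) :
      Algorithm.Reaches A D ω v 0 s ∅ t
  | next (j : Fin n) {s s' : State} {S : Finset (Fin n)} {t t' : ℕ}
      (h : Algorithm.Reaches A D ω v j s S t)
      (h' : Exec D ω A.round (present s (v j)) t' s') :
      Algorithm.Reaches A D ω v (j + 1) s' (if s'.nats 1 ≠ 0 then insert j S else S) (t + t')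

/-- `A.Allocates D ω v S t`: on the items with values `v`, with distributions `D` and random
reals `ω`, the algorithm allocates exactly the items of `S` to the first player, using `t` steps
in total. -/
def Algorithm.Allocates (A : Algorithm) (D : Fin 2 → Measure ℝ) (ω : ℕ → unitInterval)
    {n : ℕ} (v : Fin n → Fin 2 → ℝ) (S : Finset (Fin n)) (t : ℕ) : Prop :=
  ∃ s, A.Reaches D ω v n s S t

/-- The envy when the first player (index `0`) gets `S` and the second one (index `1`) gets the
complement of `S`. -/
noncomputable def envy {n : ℕ} (v : Fin n → Fin 2 → ℝ) (S : Finset (Fin n)) : ℝ :=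
  max ((∑ j ∈ Sᶜ, v j 0) - ∑ j ∈ S, v j 0) ((∑ j ∈ S, v j 1) - ∑ j ∈ Sᶜ, v j 1)

/-- The joint law of the item values and of the random reals of the algorithm: all values are
independent, those for player `p` have the law `D p`, and the random reals are independent of them,
mutually independent and uniform on `[0,1]`. -/
noncomputable def law (D : Fin 2 → Measure ℝ) (n : ℕ) :
    Measure ((Fin n → Fin 2 → ℝ) × (ℕ → unitInterval)) :=
  (Measure.pi fun _ : Fin n => Measure.pi D).prod
    (Measure.infinitePi fun _ : ℕ => (volume : Measure unitInterval))

end OnlineEnvy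

/-!
Items are points `x` of the plane, and giving an item to the first or to the second player adds `x`
or `-x` to a walk `w` whose coordinates at the end are, up to sign, the two quantities of which the
envy is the maximum. The signs are drawn independently with mean `-⟪w, x⟫ / c`. As long as
`|⟪w, x⟫| ≤ c`, this bias replaces `𝔼 exp ⟪w, θ⟫` by `𝔼 exp ⟪w, θ'⟫` with
`θ' = θ - (⟪x, θ⟫ / c) • x`, at the cost of a factor `exp (⟪x, θ⟫ ^ 2 / 2)` from the variance of the
sign. Since `c * ‖θ'‖ ^ 2 + ⟪x, θ⟫ ^ 2 ≤ c * ‖θ‖ ^ 2`, the Gaussian bound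
`𝔼 exp ⟪w, θ⟫ ≤ exp (c * ‖θ‖ ^ 2 / 2)` persists forever, however many items there are. Hence each
of the events `|⟪w, x⟫| > c`, and the event that `w` ends up with a coordinate above `c`, has
probability `exp (-Ω(c))`. The square of the binary length of `n` is a parameter `c` of order
`(log n) ^ 2` that a real RAM computes in `O(log n)` steps; with it, a union bound makes the failure
probability smaller than any power of `1 / n` for large `n`, and the envy is
`O((log n) ^ 2) ≤ n ^ O(1 / log log n)`. For the remaining small `n` the envy is at most `n`, a
bounded quantity.
-/

section Resampling

variable {ι : Type*} [DecidableEq ι] {X : ι → Type*} [∀ i, MeasurableSpace (X i)]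
  (μ : (i : ι) → Measure (X i)) [∀ i, IsProbabilityMeasure (μ i)] (j : ι)

theorem measurePreserving_update_infinitePi :
    MeasurePreserving (fun p : (∀ i, X i) × X j => Function.update p.1 j p.2)
      ((Measure.infinitePi μ).prod (μ j)) (Measure.infinitePi μ) := by
  refine ⟨measurable_update', Measure.eq_infinitePi _ fun s t ht => ?_⟩
  rw [Measure.map_apply measurable_update' (.pi s.countable_toSet fun i _ => ht i)]
  have preimage_box : (fun p : (∀ i, X i) × X j => Function.update p.1 j p.2) ⁻¹' Set.pi s t =
      Set.pi (s.erase j : Finset ι) t ×ˢ {u | j ∈ s → u ∈ t j} := by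
    ext ⟨ω, u⟩
    simp only [Set.mem_preimage, Set.mem_pi, Finset.mem_coe, Set.mem_prod, Finset.mem_erase,
      Function.forall_update_iff ω fun i y => i ∈ s → y ∈ t i]
    grind
  rw [preimage_box, Measure.prod_prod, Measure.infinitePi_pi _ fun i _ => ht i]
  by_cases hj : j ∈ s
  · simpa [hj] using Finset.prod_erase_mul s (fun i => μ i (t i)) hj
  · simp [hj]

theorem setLIntegral_infinitePi_update {s : Set (∀ i, X i)} (hs : MeasurableSet s)
    (hsj : ∀ ω u, Function.update ω j u ∈ s ↔ ω ∈ s) {f : (∀ i, X i) → ENNReal}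
    (hf : Measurable f) :
    ∫⁻ ω in s, f ω ∂Measure.infinitePi μ =
      ∫⁻ ω in s, ∫⁻ u, f (Function.update ω j u) ∂μ j ∂Measure.infinitePi μ := by
  have preserving := measurePreserving_update_infinitePi μ j
  have preimage_eq : (fun p : (∀ i, X i) × X j => Function.update p.1 j p.2) ⁻¹' s =
      s ×ˢ Set.univ := by
    ext ⟨ω, u⟩
    simp [hsj]
  rw [← preserving.setLIntegral_comp_preimage hs hf, preimage_eq, ← Measure.prod_restrict,
    Measure.restrict_univ]
  exact lintegral_prod _ (hf.comp preserving.measurable).aemeasurable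

end Resampling

/-- The random sign with mean `m` that is read off a uniformly random `u ∈ [0, 1]`. -/
noncomputable def biasedSign (m : ℝ) (u : unitInterval) : ℝ :=
  if (u : ℝ) ≤ (1 + m) / 2 then 1 else -1

@[fun_prop]
theorem measurable_biasedSign {Ω : Type*} [MeasurableSpace Ω] {m : Ω → ℝ} {u : Ω → unitInterval}
    (hm : Measurable m) (hu : Measurable u) : Measurable fun a => biasedSign (m a) (u a) :=
  .ite (measurableSet_le (by fun_prop) (by fun_prop)) measurable_const measurable_const

theorem biasedSign_mem_Icc (m : ℝ) (u : unitInterval) : biasedSign m u ∈ Set.Icc (-1 : ℝ) 1 := by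
  unfold biasedSign
  split_ifs <;> norm_num

theorem integral_biasedSign {m : ℝ} (hm : |m| ≤ 1) : ∫ u, biasedSign m u = m := by
  obtain ⟨hm_ge, hm_le⟩ := abs_le.mp hm
  let p : unitInterval := ⟨(1 + m) / 2, by linarith, by linarith⟩
  have eq_indicator : biasedSign m = fun u => 2 * (Set.Iic p).indicator 1 u - 1 := by
    funext u
    by_cases hu : (u : ℝ) ≤ (1 + m) / 2
    · have : u ∈ Set.Iic p := hu
      norm_num [biasedSign, hu, this]
    · have : u ∉ Set.Iic p := hu
      norm_num [biasedSign, hu, this]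
  have integrable_indicator : Integrable ((Set.Iic p).indicator (1 : unitInterval → ℝ)) :=
    (integrable_const 1).indicator measurableSet_Iic
  rw [eq_indicator, integral_sub (integrable_indicator.const_mul 2) (integrable_const 1),
    integral_const_mul, integral_indicator_one measurableSet_Iic, measureReal_def,
    unitInterval.volume_Iic, ENNReal.toReal_ofReal p.2.1, integral_const, probReal_univ]
  simp only [p, smul_eq_mul]
  ring

theorem lintegral_exp_mul_biasedSign_le {m : ℝ} (hm : |m| ≤ 1) (s : ℝ) :
    ∫⁻ u, ENNReal.ofReal (Real.exp (s * biasedSign m u)) ≤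
      ENNReal.ofReal (Real.exp (s * m + s ^ 2 / 2)) := by
  have subgaussian : ProbabilityTheory.HasSubgaussianMGF (fun u => biasedSign m u - m) 1 := by
    have := ProbabilityTheory.hasSubgaussianMGF_of_mem_Icc (μ := (volume : Measure unitInterval))
      (X := biasedSign m) (by fun_prop) (.of_forall (biasedSign_mem_Icc m))
    rw [integral_biasedSign hm] at this
    convert this
    ext
    norm_num
  have exp_split (u : unitInterval) : Real.exp (s * biasedSign m u) =
      Real.exp (s * m) * Real.exp (s * (biasedSign m u - m)) := by
    rw [← Real.exp_add]
    ring_nf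
  simp_rw [exp_split]
  rw [← ofReal_integral_eq_lintegral_ofReal ((subgaussian.integrable_exp_mul s).const_mul _)
    (.of_forall fun u => by positivity), integral_const_mul, Real.exp_add]
  gcongr
  simpa [ProbabilityTheory.mgf] using subgaussian.mgf_le s

namespace SelfBalancing

open scoped RealInnerProductSpace

variable {E : Type*} [NormedAddCommGroup E] [InnerProductSpace ℝ E]

/-- One step of the self-balancing walk with parameter `c`: from `w` it goes to `w ± x`, the sign
being biased towards the side of the origin, with mean `-⟪w, x⟫ / c`. -/
noncomputable def step (c : ℝ) (w x : E) (u : unitInterval) : E :=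
  w + biasedSign (-(⟪w, x⟫ / c)) u • x

/-- The self-balancing walk with increments `± x j`, driven by `ω`. -/
noncomputable def walk (c : ℝ) (x : ℕ → E) (ω : ℕ → unitInterval) : ℕ → E
  | 0 => 0
  | j + 1 => step c (walk c x ω j) (x j) (ω j)

/-- Before time `j` the biases of the signs were at most `1` in absolute value, so that they were
the means of the signs. -/
def Tame (c : ℝ) (x : ℕ → E) (ω : ℕ → unitInterval) (j : ℕ) : Prop :=
  ∀ i < j, |⟪walk c x ω i, x i⟫| ≤ c

/-- The law of the sequence of random reals that drives the walk. -/
noncomputable abbrev uniformDraws : Measure (ℕ → unitInterval) :=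
  Measure.infinitePi fun _ => volume

theorem walk_congr {c : ℝ} {x : ℕ → E} {ω ω' : ℕ → unitInterval} {j : ℕ}
    (h : ∀ i < j, ω i = ω' i) : walk c x ω j = walk c x ω' j := by
  induction j with
  | zero => rfl
  | succ j ih => rw [walk, walk, ih fun i hi => h i (by omega), h j (by omega)]

theorem walk_update (c : ℝ) (x : ℕ → E) (ω : ℕ → unitInterval) {i j : ℕ} (h : i ≤ j)
    (u : unitInterval) : walk c x (Function.update ω j u) i = walk c x ω i :=
  walk_congr fun _ hi => Function.update_of_ne (by omega) _ _

theorem tame_succ_update (c : ℝ) (x : ℕ → E) (ω : ℕ → unitInterval) (j : ℕ) (u : unitInterval) :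
    Tame c x (Function.update ω j u) (j + 1) ↔ Tame c x ω (j + 1) :=
  forall₂_congr fun i hi => by rw [walk_update c x ω (by omega)]

theorem exists_tame_lt_abs_inner_of_not_tame {c : ℝ} {x : ℕ → E} {ω : ℕ → unitInterval} {n : ℕ}
    (h : ¬ Tame c x ω n) : ∃ j < n, Tame c x ω j ∧ c < |⟪walk c x ω j, x j⟫| := by
  simp only [Tame, not_forall, not_le] at h
  obtain ⟨j, ⟨hj, hlt⟩, hmin⟩ := WellFounded.has_min (wellFounded_lt (α := ℕ))
    {j | j < n ∧ c < |⟪walk c x ω j, x j⟫|} (by simpa [Set.Nonempty] using h)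
  exact ⟨j, hj, fun i hi => not_lt.mp fun hlt => hmin i ⟨hi.trans hj, hlt⟩ hi, hlt⟩

theorem lintegral_exp_inner_step_le {c : ℝ} {w x : E} (hw : |⟪w, x⟫| ≤ c) (θ : E) :
    ∫⁻ u, ENNReal.ofReal (Real.exp ⟪step c w x u, θ⟫) ≤
      ENNReal.ofReal (Real.exp ⟪w, θ - (⟪x, θ⟫ / c) • x⟫) *
        ENNReal.ofReal (Real.exp (⟪x, θ⟫ ^ 2 / 2)) := by
  have bias_le : |-(⟪w, x⟫ / c)| ≤ 1 := by
    have hc : 0 ≤ c := (abs_nonneg _).trans hw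
    rw [abs_neg, abs_div, abs_of_nonneg hc]
    exact div_le_one_of_le₀ hw hc
  have inner_step (u : unitInterval) :
      ⟪step c w x u, θ⟫ = ⟪w, θ⟫ + ⟪x, θ⟫ * biasedSign (-(⟪w, x⟫ / c)) u := by
    rw [step, inner_add_left, real_inner_smul_left, mul_comm]
  calc ∫⁻ u, ENNReal.ofReal (Real.exp ⟪step c w x u, θ⟫)
      = ENNReal.ofReal (Real.exp ⟪w, θ⟫) *
          ∫⁻ u, ENNReal.ofReal (Real.exp (⟪x, θ⟫ * biasedSign (-(⟪w, x⟫ / c)) u)) := by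
        simp_rw [inner_step, Real.exp_add, ENNReal.ofReal_mul (Real.exp_pos _).le]
        exact lintegral_const_mul' _ _ ENNReal.ofReal_ne_top
    _ ≤ ENNReal.ofReal (Real.exp ⟪w, θ⟫) *
          ENNReal.ofReal (Real.exp (⟪x, θ⟫ * -(⟪w, x⟫ / c) + ⟪x, θ⟫ ^ 2 / 2)) := by
        gcongr
        exact lintegral_exp_mul_biasedSign_le bias_le _
    _ = _ := by
        simp_rw [← ENNReal.ofReal_mul (Real.exp_pos _).le, ← Real.exp_add, inner_sub_right,
          real_inner_smul_right]
        ring_nf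

theorem mul_norm_sub_smul_sq_add_inner_sq_le {c : ℝ} (hc : 0 < c) {x : E} (hx : ‖x‖ ^ 2 ≤ c)
    (θ : E) : c * ‖θ - (⟪x, θ⟫ / c) • x‖ ^ 2 + ⟪x, θ⟫ ^ 2 ≤ c * ‖θ‖ ^ 2 := by
  have expand : c * ‖θ - (⟪x, θ⟫ / c) • x‖ ^ 2 =
      c * ‖θ‖ ^ 2 - 2 * ⟪x, θ⟫ ^ 2 + ⟪x, θ⟫ ^ 2 * (‖x‖ ^ 2 / c) := by
    rw [norm_sub_sq_real, real_inner_smul_right, norm_smul, mul_pow, Real.norm_eq_abs, sq_abs,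
      real_inner_comm]
    field_simp
  have : ⟪x, θ⟫ ^ 2 * (‖x‖ ^ 2 / c) ≤ ⟪x, θ⟫ ^ 2 :=
    mul_le_of_le_one_right (sq_nonneg _) ((div_le_one hc).mpr hx)
  linarith

variable [MeasurableSpace E] [BorelSpace E] [SecondCountableTopology E]

theorem measurable_walk {Ω : Type*} [MeasurableSpace Ω] (c : ℝ) {x : Ω → ℕ → E}
    {ω : Ω → ℕ → unitInterval} (hx : ∀ i, Measurable fun a => x a i)
    (hω : ∀ i, Measurable fun a => ω a i) (j : ℕ) : Measurable fun a => walk c (x a) (ω a) j := by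
  induction j with
  | zero => exact measurable_const
  | succ j ih =>
    simp only [walk, step]
    fun_prop

theorem measurable_inner_walk (c : ℝ) (x : ℕ → E) (θ : E) (j : ℕ) :
    Measurable fun ω => ⟪walk c x ω j, θ⟫ :=
  have := measurable_walk (x := fun _ => x) c (fun _ => measurable_const) measurable_pi_apply j
  this.inner_const

theorem measurableSet_tame (c : ℝ) (x : ℕ → E) (j : ℕ) : MeasurableSet {ω | Tame c x ω j} := by
  simp only [Tame, Set.ofPred_forall]
  exact .iInter fun i => .iInter fun _ =>
    measurableSet_le (measurable_inner_walk c x (x i) i).abs measurable_const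

/-- The step in direction `θ` is absorbed by moving `θ` to the point `θ - (⟪x, θ⟫ / c) • x`, whose
norm is smaller by just enough to pay for the variance of the sign. -/
theorem setLIntegral_exp_inner_walk_le {c : ℝ} (hc : 0 < c) {x : ℕ → E}
    (hx : ∀ j, ‖x j‖ ^ 2 ≤ c) (j : ℕ) (θ : E) :
    ∫⁻ ω in {ω | Tame c x ω j}, ENNReal.ofReal (Real.exp ⟪walk c x ω j, θ⟫) ∂uniformDraws ≤
      ENNReal.ofReal (Real.exp (c * ‖θ‖ ^ 2 / 2)) := by
  induction j generalizing θ with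
  | zero =>
    have : 1 ≤ Real.exp (c * ‖θ‖ ^ 2 / 2) := Real.one_le_exp (by positivity)
    simpa [Tame, walk] using this
  | succ j ih =>
    set θ' := θ - (⟪x j, θ⟫ / c) • x j
    calc _ = ∫⁻ ω in {ω | Tame c x ω (j + 1)},
            ∫⁻ u, ENNReal.ofReal (Real.exp ⟪step c (walk c x ω j) (x j) u, θ⟫) ∂volume
              ∂uniformDraws := by
          rw [setLIntegral_infinitePi_update _ j (measurableSet_tame c x (j + 1))
            (fun ω u => tame_succ_update c x ω j u)
            (measurable_inner_walk c x θ (j + 1)).exp.ennreal_ofReal]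
          simp only [walk, walk_update c x _ le_rfl, Function.update_self]
      _ ≤ ∫⁻ ω in {ω | Tame c x ω (j + 1)}, ENNReal.ofReal (Real.exp ⟪walk c x ω j, θ'⟫) *
            ENNReal.ofReal (Real.exp (⟪x j, θ⟫ ^ 2 / 2)) ∂uniformDraws :=
          setLIntegral_mono' (measurableSet_tame c x (j + 1)) fun ω hω =>
            lintegral_exp_inner_step_le (hω j j.lt_succ_self) θ
      _ ≤ ∫⁻ ω in {ω | Tame c x ω j}, ENNReal.ofReal (Real.exp ⟪walk c x ω j, θ'⟫) *
            ENNReal.ofReal (Real.exp (⟪x j, θ⟫ ^ 2 / 2)) ∂uniformDraws :=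
          lintegral_mono_set fun ω hω i hi => hω i (hi.trans j.lt_succ_self)
      _ ≤ ENNReal.ofReal (Real.exp (c * ‖θ'‖ ^ 2 / 2)) *
            ENNReal.ofReal (Real.exp (⟪x j, θ⟫ ^ 2 / 2)) := by
          rw [lintegral_mul_const' _ _ ENNReal.ofReal_ne_top]
          gcongr
          exact ih θ'
      _ ≤ _ := by
          rw [← ENNReal.ofReal_mul (Real.exp_pos _).le, ← Real.exp_add, ← add_div]
          gcongr
          exact mul_norm_sub_smul_sq_add_inner_sq_le hc (hx j) θ

theorem measure_tame_and_le_inner_walk_le {c : ℝ} (hc : 0 < c) {x : ℕ → E}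
    (hx : ∀ j, ‖x j‖ ^ 2 ≤ c) (j : ℕ) {B : ℝ} (hB : 0 < B) {θ : E} (hθ : ‖θ‖ ^ 2 ≤ B) {a : ℝ}
    (ha : 0 ≤ a) :
    uniformDraws {ω | Tame c x ω j ∧ a ≤ ⟪walk c x ω j, θ⟫} ≤
      ENNReal.ofReal (Real.exp (-(a ^ 2 / (2 * c * B)))) := by
  -- The minimizer of the Chernoff exponent `c * s ^ 2 * B / 2 - s * a`.
  set s := a / (c * B) with hs
  have measurable_exp := (measurable_inner_walk c x (s • θ) j).exp.ennreal_ofReal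
  have exponent_le : c * ‖s • θ‖ ^ 2 / 2 - s * a ≤ -(a ^ 2 / (2 * c * B)) := by
    calc c * ‖s • θ‖ ^ 2 / 2 - s * a = c * (s ^ 2 * ‖θ‖ ^ 2) / 2 - s * a := by
          rw [norm_smul, mul_pow, Real.norm_eq_abs, sq_abs]
      _ ≤ c * (s ^ 2 * B) / 2 - s * a := by gcongr
      _ = -(a ^ 2 / (2 * c * B)) := by
          rw [hs]
          field_simp
          ring
  calc uniformDraws {ω | Tame c x ω j ∧ a ≤ ⟪walk c x ω j, θ⟫}
      ≤ uniformDraws ({ω | ENNReal.ofReal (Real.exp (s * a)) ≤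
          ENNReal.ofReal (Real.exp ⟪walk c x ω j, s • θ⟫)} ∩ {ω | Tame c x ω j}) := by
        refine measure_mono fun ω ⟨tame, hle⟩ => ⟨?_, tame⟩
        rw [Set.mem_ofPred_eq, real_inner_smul_right]
        gcongr
    _ ≤ (∫⁻ ω in {ω | Tame c x ω j}, ENNReal.ofReal (Real.exp ⟪walk c x ω j, s • θ⟫)
          ∂uniformDraws) / ENNReal.ofReal (Real.exp (s * a)) := by
        rw [← Measure.restrict_apply (measurableSet_le measurable_const measurable_exp)]
        exact meas_ge_le_lintegral_div measurable_exp.aemeasurable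
          (ENNReal.ofReal_pos.mpr (Real.exp_pos _)).ne' ENNReal.ofReal_ne_top
    _ ≤ ENNReal.ofReal (Real.exp (c * ‖s • θ‖ ^ 2 / 2)) / ENNReal.ofReal (Real.exp (s * a)) := by
        gcongr
        exact setLIntegral_exp_inner_walk_le hc hx j (s • θ)
    _ ≤ _ := by
        rw [← ENNReal.ofReal_div_of_pos (Real.exp_pos _), ← Real.exp_sub]
        gcongr

theorem measure_tame_and_le_abs_inner_walk_le {c : ℝ} (hc : 0 < c) {x : ℕ → E}
    (hx : ∀ j, ‖x j‖ ^ 2 ≤ c) (j : ℕ) {B : ℝ} (hB : 0 < B) {θ : E} (hθ : ‖θ‖ ^ 2 ≤ B) {a : ℝ}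
    (ha : 0 ≤ a) :
    uniformDraws {ω | Tame c x ω j ∧ a ≤ |⟪walk c x ω j, θ⟫|} ≤
      2 * ENNReal.ofReal (Real.exp (-(a ^ 2 / (2 * c * B)))) := by
  have subset_union : {ω | Tame c x ω j ∧ a ≤ |⟪walk c x ω j, θ⟫|} ⊆
      {ω | Tame c x ω j ∧ a ≤ ⟪walk c x ω j, θ⟫} ∪
        {ω | Tame c x ω j ∧ a ≤ ⟪walk c x ω j, -θ⟫} := by
    rintro ω ⟨tame, hle⟩
    exact (le_abs.mp hle).imp (⟨tame, ·⟩) fun h => ⟨tame, by rwa [inner_neg_right]⟩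
  refine (measure_mono subset_union).trans <| (measure_union_le _ _).trans ?_
  rw [two_mul]
  exact add_le_add (measure_tame_and_le_inner_walk_le hc hx j hB hθ ha)
    (measure_tame_and_le_inner_walk_le hc hx j hB (by rwa [norm_neg]) ha)

/-- Union bound over the test directions at time `n` and over the times before `n` at which the walk
may cease to be tame; the increment at such a time is one more test direction. -/
theorem measure_exists_lt_abs_inner_walk_le {B c : ℝ} (hB : 0 < B) (hBc : B ≤ c) {x : ℕ → E}
    (hx : ∀ j, ‖x j‖ ^ 2 ≤ B) {ι : Type*} [Fintype ι] {θ : ι → E} (hθ : ∀ i, ‖θ i‖ ^ 2 ≤ B)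
    (n : ℕ) :
    uniformDraws {ω | ∃ i, c < |⟪walk c x ω n, θ i⟫|} ≤
      (n + Fintype.card ι) * (2 * ENNReal.ofReal (Real.exp (-(c / (2 * B))))) := by
  have hc : 0 < c := hB.trans_le hBc
  have tail {j : ℕ} {y : E} (hy : ‖y‖ ^ 2 ≤ B) :
      uniformDraws {ω | Tame c x ω j ∧ c ≤ |⟪walk c x ω j, y⟫|} ≤
        2 * ENNReal.ofReal (Real.exp (-(c / (2 * B)))) := by
    convert measure_tame_and_le_abs_inner_walk_le hc (fun j => (hx j).trans hBc) j hB hy hc.le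
      using 5
    field_simp
  have subset_union : {ω | ∃ i, c < |⟪walk c x ω n, θ i⟫|} ⊆
      (⋃ j ∈ Finset.range n, {ω | Tame c x ω j ∧ c ≤ |⟪walk c x ω j, x j⟫|}) ∪
        ⋃ i ∈ Finset.univ, {ω | Tame c x ω n ∧ c ≤ |⟪walk c x ω n, θ i⟫|} := by
    rintro ω ⟨i, hi⟩
    by_cases tame : Tame c x ω n
    · exact .inr (Set.mem_biUnion (Finset.mem_univ i) ⟨tame, hi.le⟩)
    · obtain ⟨j, hj, tame_j, hlt⟩ := exists_tame_lt_abs_inner_of_not_tame tame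
      exact .inl (Set.mem_biUnion (Finset.mem_range.mpr hj) ⟨tame_j, hlt.le⟩)
  refine (measure_mono subset_union).trans <| (measure_union_le _ _).trans ?_
  rw [add_mul]
  gcongr
  · simpa using (measure_biUnion_finset_le _ _).trans
      (Finset.sum_le_card_nsmul (Finset.range n) _ _ fun j _ => tail (hx j))
  · simpa using (measure_biUnion_finset_le _ _).trans
      (Finset.sum_le_card_nsmul Finset.univ _ _ fun i _ => tail (hθ i))

end SelfBalancing

namespace RealRAM

theorem Exec.deterministic {D : Fin 2 → Measure ℝ} {ω : ℕ → unitInterval} {c : Program}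
    {s s₁ s₂ : State} {t₁ t₂ : ℕ} (h₁ : Exec D ω c s t₁ s₁) (h₂ : Exec D ω c s t₂ s₂) :
    t₁ = t₂ ∧ s₁ = s₂ := by
  induction h₁ generalizing t₂ s₂ <;> cases h₂ <;> grind

/-- The natural number in the cell with the fixed address `k`. -/
abbrev NatExpr.reg (k : ℕ) : NatExpr := .cell (.lit k)

/-- The real number in the cell with the fixed address `k`. -/
abbrev RealExpr.reg (k : ℕ) : RealExpr := .cell (.lit k)

/-- A natural number as a real constant. -/
abbrev RealExpr.const (k : ℕ) : RealExpr := .ofNat (.lit k)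

end RealRAM

namespace OnlineEnvy

open RealRAM SelfBalancing

open scoped RealInnerProductSpace

/-- Doubles the number in cell `2` until it exceeds `n`, and counts the doublings in the real
cell `5`: this computes the binary length of `n`. -/
def doublingLoop : Program :=
  .loop (.natLe (.reg 2) (.reg 0))
    (.seq (.setNat (.lit 2) (.add (.reg 2) (.reg 2)))
      (.setReal (.lit 5) (.add (.reg 5) (.const 1))))

/-- Decides whether the current item goes to the first player, that is, whether its sign in the walk
is `+1`. -/
def signTest : Test :=
  .realLe (.reg 4)
    (.div
      (.sub (.const 1) (.div (.add (.mul (.reg 2) (.reg 0)) (.mul (.reg 3) (.reg 1))) (.reg 5)))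
      (.const 2))

/-- The sign with which the current item enters the walk, as determined by the decision in cell `1`
of the natural number memory. -/
def signExpr : RealExpr := .sub (.ofNat (.reg 1)) (.ofNat (.sub (.lit 1) (.reg 1)))

/-- The self-balancing walk in the plane with the items as increments, where the sign `+1` stands
for the first player. The real cell `5` holds the parameter of the walk, the cells `2` and `3` hold
its position, and the cell `4` the random real of the current round. -/
def balancing : Algorithm where
  setup :=
    .seq (.setNat (.lit 2) (.lit 1))
      (.seq doublingLoop
        (.setReal (.lit 5) (.mul (.reg 5) (.reg 5))))
  round :=
    .seq (.draw (.lit 4))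
      (.seq
        (.ite signTest (.setNat (.lit 1) (.lit 1)) (.setNat (.lit 1) (.lit 0)))
        (.seq (.setReal (.lit 2) (.add (.reg 2) (.mul signExpr (.reg 0))))
          (.setReal (.lit 3) (.add (.reg 3) (.mul signExpr (.reg 1))))))

/-- The parameter of the walk for `n` items: the square of the binary length of `n`, which is of
order `(log n) ^ 2` and can be computed without evaluating logarithms. -/
noncomputable def scale (n : ℕ) : ℝ := (n.size : ℝ) ^ 2

/-- The position of the walk that is stored in the memory. -/
noncomputable def position (s : State) : EuclideanSpace ℝ (Fin 2) := !₂[s.reals 2, s.reals 3]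

/-- The increments of the walk: the items as points of the plane, followed by zeros. -/
noncomputable def increments {n : ℕ} (v : Fin n → Fin 2 → ℝ) (j : ℕ) : EuclideanSpace ℝ (Fin 2) :=
  if h : j < n then WithLp.toLp 2 (v ⟨j, h⟩) else 0

section Execution

variable (D : Fin 2 → Measure ℝ) (ω : ℕ → unitInterval)

theorem exec_doublingLoop {n i d : ℕ} {s : State} (hi : i + d = n.size) (hn : s.nats 0 = n)
    (hpow : s.nats 2 = 2 ^ i) (hcount : s.reals 5 = i) :
    ∃ s', Exec D ω doublingLoop s (3 * d + 1) s' ∧ s'.reals 5 = n.size ∧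
      position s' = position s ∧ s'.draws = s.draws := by
  induction d generalizing i s with
  | zero =>
    refine ⟨s, .loop_done ?_, by rw [hcount, ← hi, add_zero], rfl, rfl⟩
    simpa [Test.Holds, NatExpr.eval, hn, hpow, hi.symm] using Nat.size_le.mp hi.ge
  | succ d ih =>
    have test_holds : (Test.natLe (.reg 2) (.reg 0)).Holds D s := by
      simpa [Test.Holds, NatExpr.eval, hn, hpow] using Nat.lt_size.mp (by omega : i < n.size)
    let s₁ : State :=
      { s with
        nats := Function.update s.nats 2 (s.nats 2 + s.nats 2)
        reals := Function.update s.reals 5 (s.reals 5 + 1) }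
    have body : Exec D ω (.seq (.setNat (.lit 2) (.add (.reg 2) (.reg 2)))
        (.setReal (.lit 5) (.add (.reg 5) (.const 1)))) s 2 s₁ := by
      simpa [NatExpr.eval, RealExpr.eval] using
        Exec.seq (D := D) (ω := ω) (.setNat (.lit 2) (.add (.reg 2) (.reg 2)) s)
          (.setReal (.lit 5) (.add (.reg 5) (.const 1)) _)
    obtain ⟨s', rest, hsize, hposition, hdraws⟩ := ih (i := i + 1) (s := s₁) (by omega)
      (by simpa [s₁] using hn) (by simp [s₁, hpow, pow_succ, mul_two]) (by simp [s₁, hcount])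
    refine ⟨s', ?_, hsize, by simpa [s₁, position] using hposition, hdraws⟩
    rw [show 3 * (d + 1) + 1 = 2 + (3 * d + 1) + 1 by ring]
    exact .loop_next test_holds body rest

theorem exec_setup (n : ℕ) :
    ∃ s, Exec D ω balancing.setup (startState n) (3 * n.size + 3) s ∧
      s.reals 5 = scale n ∧ position s = 0 ∧ s.draws = 0 := by
  obtain ⟨s, run, hsize, hposition, hdraws⟩ := exec_doublingLoop D ω (n := n) (i := 0)
    (s := { startState n with nats := Function.update (startState n).nats 2 1 })
    (zero_add _) (by simp [startState]) (by simp) (by simp [startState])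
  have run_setup := Exec.seq (.setNat (.lit 2) (.lit 1) (startState n))
    (.seq run (.setReal (.lit 5) (.mul (.reg 5) (.reg 5)) s))
  rw [show 1 + (3 * n.size + 1 + 1) = 3 * n.size + 3 by ring] at run_setup
  refine ⟨_, run_setup, ?_, ?_, hdraws⟩
  · simp [NatExpr.eval, RealExpr.eval, hsize, scale, sq]
  · have position_eq : position s = 0 := by
      rw [hposition]
      ext p
      fin_cases p <;> rfl
    simpa [position, NatExpr.eval] using position_eq

theorem exec_round (s : State) (x : Fin 2 → ℝ) :
    ∃ s', Exec D ω balancing.round (present s x) 5 s' ∧ s'.reals 5 = s.reals 5 ∧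
      position s' = step (s.reals 5) (position s) (WithLp.toLp 2 x) (ω s.draws) ∧
      s'.draws = s.draws + 1 ∧
      biasedSign (-(⟪position s, WithLp.toLp 2 x⟫ / s.reals 5)) (ω s.draws) =
        if s'.nats 1 ≠ 0 then 1 else -1 := by
  have test_iff : signTest.Holds D
        { present s x with
          reals := Function.update (present s x).reals 4 (ω s.draws : ℝ)
          draws := s.draws + 1 } ↔
      (ω s.draws : ℝ) ≤ (1 + -(⟪position s, WithLp.toLp 2 x⟫ / s.reals 5)) / 2 := by
    simp [signTest, Test.Holds, NatExpr.eval, RealExpr.eval, present, position, PiLp.inner_apply,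
      sub_eq_add_neg, mul_comm]
  have draw := Exec.draw (D := D) (ω := ω) (.lit 4) (present s x)
  by_cases h : (ω s.draws : ℝ) ≤ (1 + -(⟪position s, WithLp.toLp 2 x⟫ / s.reals 5)) / 2
  · have sign_eq : biasedSign (-(⟪position s, WithLp.toLp 2 x⟫ / s.reals 5)) (ω s.draws) = 1 :=
      if_pos h
    rw [step, sign_eq]
    refine ⟨_, .seq draw (.seq (.ite_true (test_iff.mpr h) (.setNat _ _ _))
      (.seq (.setReal _ _ _) (.setReal _ _ _))), ?_, ?_, rfl, ?_⟩
    · simp [NatExpr.eval, present]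
    · ext p
      fin_cases p <;> simp [NatExpr.eval, RealExpr.eval, signExpr, present, position]
    · simp [NatExpr.eval]
  · have sign_eq : biasedSign (-(⟪position s, WithLp.toLp 2 x⟫ / s.reals 5)) (ω s.draws) = -1 :=
      if_neg h
    rw [step, sign_eq]
    refine ⟨_, .seq draw (.seq (.ite_false (mt test_iff.mp h) (.setNat _ _ _))
      (.seq (.setReal _ _ _) (.setReal _ _ _))), ?_, ?_, rfl, ?_⟩
    · simp [NatExpr.eval, present]
    · ext p
      fin_cases p <;> simp [NatExpr.eval, RealExpr.eval, signExpr, present, position]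
    · simp [NatExpr.eval]

end Execution

section Run

/-- The state after `j` items: the cells hold the parameter and the position of the walk, one random
real per item has been drawn, and `S` is the set of items whose sign is `+1`. -/
structure Invariant (ω : ℕ → unitInterval) {n : ℕ} (v : Fin n → Fin 2 → ℝ) (j : ℕ) (s : State)
    (S : Finset (Fin n)) : Prop where
  scale_eq : s.reals 5 = scale n
  position_eq : position s = walk (scale n) (increments v) ω j
  draws_eq : s.draws = j
  lt_of_mem : ∀ i ∈ S, (i : ℕ) < j
  walk_eq : walk (scale n) (increments v) ω j =
    (2 : ℝ) • ∑ i ∈ S, WithLp.toLp 2 (v i) - ∑ i ∈ Finset.range j, increments v i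

variable {D : Fin 2 → Measure ℝ} {ω : ℕ → unitInterval} {n : ℕ} {v : Fin n → Fin 2 → ℝ}

theorem increments_val (v : Fin n → Fin 2 → ℝ) (j : Fin n) :
    increments v j = WithLp.toLp 2 (v j) := by
  simp [increments]

theorem Invariant.next {j : Fin n} {s s' : State} {S : Finset (Fin n)} {t : ℕ}
    (h : Invariant ω v j s S) (run : Exec D ω balancing.round (present s (v j)) t s') :
    Invariant ω v (j + 1) s' (if s'.nats 1 ≠ 0 then insert j S else S) := by
  obtain ⟨s'', run', hscale, hposition, hdraws, hsign⟩ := exec_round D ω s (v j)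
  obtain ⟨rfl, rfl⟩ := run.deterministic run'
  rw [h.scale_eq, h.position_eq, h.draws_eq] at hposition hsign
  have not_mem : j ∉ S := fun hj => (h.lt_of_mem j hj).false
  refine ⟨hscale.trans h.scale_eq, ?_, by rw [hdraws, h.draws_eq], ?_, ?_⟩
  · rw [hposition, walk, increments_val]
  · split_ifs
    · refine (Finset.forall_mem_insert _ _ _).mpr ⟨j.val.lt_succ_self, fun i hi => ?_⟩
      exact (h.lt_of_mem i hi).trans j.val.lt_succ_self
    · exact fun i hi => (h.lt_of_mem i hi).trans j.val.lt_succ_self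
  · rw [walk, step, increments_val, hsign, h.walk_eq, Finset.sum_range_succ, increments_val]
    split_ifs
    · rw [Finset.sum_insert not_mem]
      module
    · module

theorem invariant_of_reaches {j : ℕ} {s : State} {S : Finset (Fin n)} {t : ℕ}
    (h : balancing.Reaches D ω v j s S t) : Invariant ω v j s S := by
  induction h with
  | start run =>
    obtain ⟨s', run', hscale, hposition, hdraws⟩ := exec_setup D ω n
    obtain ⟨rfl, rfl⟩ := run.deterministic run'
    exact ⟨hscale, hposition, hdraws, by simp, by simp [walk]⟩
  | next j _ run ih => exact ih.next run

theorem exists_reaches (D : Fin 2 → Measure ℝ) (ω : ℕ → unitInterval) (v : Fin n → Fin 2 → ℝ)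
    {j : ℕ} (hj : j ≤ n) : ∃ s S, balancing.Reaches D ω v j s S (3 * n.size + 3 + 5 * j) := by
  induction j with
  | zero =>
    obtain ⟨s, run, -⟩ := exec_setup D ω n
    exact ⟨s, ∅, .start run⟩
  | succ j ih =>
    obtain ⟨s, S, reaches⟩ := ih (by omega)
    obtain ⟨s', run, -⟩ := exec_round D ω s (v ⟨j, hj⟩)
    have next := Algorithm.Reaches.next ⟨j, hj⟩ reaches run
    exact ⟨s', _, next⟩

theorem exists_allocates (D : Fin 2 → Measure ℝ) (ω : ℕ → unitInterval) (v : Fin n → Fin 2 → ℝ) :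
    ∃ S t, balancing.Allocates D ω v S t ∧ t ≤ 8 * n + 3 := by
  obtain ⟨s, S, reaches⟩ := exists_reaches D ω v le_rfl
  have : n.size ≤ n := Nat.size_le.mpr Nat.lt_two_pow_self
  exact ⟨S, _, ⟨s, reaches⟩, by omega⟩

theorem Algorithm.Allocates.walk_apply {S : Finset (Fin n)} {t : ℕ}
    (h : balancing.Allocates D ω v S t) (p : Fin 2) :
    walk (scale n) (increments v) ω n p = ∑ i ∈ S, v i p - ∑ i ∈ Sᶜ, v i p := by
  obtain ⟨s, reaches⟩ := h
  have sum_increments : ∑ i ∈ Finset.range n, increments v i =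
      ∑ i ∈ S, WithLp.toLp 2 (v i) + ∑ i ∈ Sᶜ, WithLp.toLp 2 (v i) := by
    simp_rw [Finset.sum_add_sum_compl, ← Fin.sum_univ_eq_sum_range, increments_val]
  rw [(invariant_of_reaches reaches).walk_eq, sum_increments]
  simp
  ring

theorem Algorithm.Allocates.exists_lt_abs_inner_walk {S : Finset (Fin n)} {t : ℕ}
    (h : balancing.Allocates D ω v S t) {a : ℝ} (ha : a < envy v S) :
    ∃ p : Fin 2, a < |⟪walk (scale n) (increments v) ω n, EuclideanSpace.single p 1⟫| := by
  simp only [EuclideanSpace.inner_single_right, one_mul, conj_trivial, h.walk_apply]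
  obtain ha | ha := lt_max_iff.mp ha
  · exact ⟨0, by rw [abs_sub_comm]; exact ha.trans_le (le_abs_self _)⟩
  · exact ⟨1, ha.trans_le (le_abs_self _)⟩

end Run

section BoundedValues

variable {n : ℕ}

theorem envy_le_card {v : Fin n → Fin 2 → ℝ} (hv : ∀ j p, v j p ∈ Set.Icc (0 : ℝ) 1)
    (S : Finset (Fin n)) : envy v S ≤ n := by
  have sub_le (T U : Finset (Fin n)) (p : Fin 2) : ∑ j ∈ T, v j p - ∑ j ∈ U, v j p ≤ n :=
    calc ∑ j ∈ T, v j p - ∑ j ∈ U, v j p ≤ ∑ j ∈ T, v j p :=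
          sub_le_self _ (Finset.sum_nonneg fun j _ => (hv j p).1)
      _ ≤ ∑ _j ∈ T, (1 : ℝ) := Finset.sum_le_sum fun j _ => (hv j p).2
      _ ≤ n := by simpa using T.card_le_univ
  exact max_le (sub_le _ _ _) (sub_le _ _ _)

theorem norm_sq_increments_le {v : Fin n → Fin 2 → ℝ} (hv : ∀ j p, v j p ∈ Set.Icc (0 : ℝ) 1)
    (j : ℕ) : ‖increments v j‖ ^ 2 ≤ 2 := by
  unfold increments
  split_ifs with h
  · have sq_le (p : Fin 2) : v ⟨j, h⟩ p ^ 2 ≤ 1 := pow_le_one₀ (hv _ p).1 (hv _ p).2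
    rw [EuclideanSpace.real_norm_sq_eq, Fin.sum_univ_two]
    linarith [sq_le 0, sq_le 1]
  · norm_num

theorem measurableSet_lt_abs_inner_walk (c : ℝ) (n : ℕ) :
    MeasurableSet {x : (Fin n → Fin 2 → ℝ) × (ℕ → unitInterval) |
      ∃ p : Fin 2, c < |⟪walk c (increments x.1) x.2 n, EuclideanSpace.single p 1⟫|} := by
  have measurable_increments (j : ℕ) :
      Measurable fun x : (Fin n → Fin 2 → ℝ) × (ℕ → unitInterval) => increments x.1 j := by
    unfold increments
    split_ifs <;> fun_prop
  have := measurable_walk c measurable_increments (ω := Prod.snd) (by fun_prop) n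
  simp only [Set.ofPred_exists]
  exact .iUnion fun p => measurableSet_lt measurable_const this.inner_const.abs

variable {ν : Measure (Fin n → Fin 2 → ℝ)}

theorem measure_exists_lt_abs_inner_walk_increments_le [IsProbabilityMeasure ν]
    (hν : ∀ᵐ v ∂ν, ∀ j p, v j p ∈ Set.Icc (0 : ℝ) 1) {c : ℝ} (hc : 2 ≤ c) :
    (ν.prod uniformDraws) {x | ∃ p : Fin 2,
        c < |⟪walk c (increments x.1) x.2 n, EuclideanSpace.single p 1⟫|} ≤
      (n + 2) * (2 * ENNReal.ofReal (Real.exp (-(c / 4)))) := by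
  rw [Measure.prod_apply (measurableSet_lt_abs_inner_walk c n)]
  refine (lintegral_mono_ae (g := fun _ => (n + 2) * (2 * ENNReal.ofReal (Real.exp (-(c / 4)))))
    ?_).trans (by simp)
  filter_upwards [hν] with v hv
  exact (measure_exists_lt_abs_inner_walk_le zero_lt_two hc (norm_sq_increments_le hv)
    (θ := fun p : Fin 2 => EuclideanSpace.single p 1) (by simp) n).trans_eq (by norm_num)

theorem measure_card_lt_envy (hν : ∀ᵐ v ∂ν, ∀ j p, v j p ∈ Set.Icc (0 : ℝ) 1) :
    (ν.prod uniformDraws) {x | ∃ S, (n : ℝ) < envy x.1 S} = 0 := by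
  refine measure_mono_null ?_ (ae_iff.mp (Measure.quasiMeasurePreserving_fst.ae hν))
  rintro x ⟨S, hS⟩ hx
  exact hS.not_ge (envy_le_card hx S)

end BoundedValues

theorem ae_mem_Icc (D : Fin 2 → Measure ℝ) [∀ i, IsProbabilityMeasure (D i)]
    (hD : ∀ i, D i (Set.Icc 0 1) = 1) (n : ℕ) :
    ∀ᵐ v ∂(Measure.pi fun _ : Fin n => Measure.pi D), ∀ j p, v j p ∈ Set.Icc (0 : ℝ) 1 := by
  have mem_Icc (p : Fin 2) : ∀ᵐ y ∂(D p), y ∈ Set.Icc (0 : ℝ) 1 :=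
    (prob_compl_eq_zero_iff measurableSet_Icc).mpr (hD p)
  have mem_Icc_pi : ∀ᵐ x ∂(Measure.pi D), ∀ p, x p ∈ Set.Icc (0 : ℝ) 1 :=
    ae_all_iff.mpr fun p => (Measure.quasiMeasurePreserving_eval D p).ae (mem_Icc p)
  exact ae_all_iff.mpr fun j =>
    (Measure.quasiMeasurePreserving_eval (fun _ : Fin n => Measure.pi D) j).ae mem_Icc_pi

section Logarithm

variable {n : ℕ}

theorem one_lt_log (hn : 3 ≤ n) : 1 < Real.log n := by
  have : (3 : ℝ) ≤ n := by exact_mod_cast hn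
  rw [Real.lt_log_iff_exp_lt (by positivity)]
  exact Real.exp_one_lt_three.trans_le this

theorem log_le_size (n : ℕ) : Real.log n ≤ n.size := by
  obtain rfl | hn := n.eq_zero_or_pos
  · simp
  calc Real.log n ≤ Real.log (2 ^ n.size) :=
        Real.log_le_log (by positivity) (by exact_mod_cast n.lt_size_self.le)
    _ = n.size * Real.log 2 := Real.log_pow _ _
    _ ≤ n.size := mul_le_of_le_one_right (by positivity) (by linarith [Real.log_two_lt_d9])

theorem size_le_three_mul_log (hn : 3 ≤ n) : n.size ≤ 3 * Real.log n := by
  have hpos : 0 < n.size := Nat.size_pos.mpr (by omega)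
  have two_pow_le : (2 : ℝ) ^ (n.size - 1) ≤ n := by
    exact_mod_cast Nat.lt_size.mp (Nat.sub_one_lt_of_lt hpos)
  have le_log : (n.size - 1) * Real.log 2 ≤ Real.log n := by
    rw [← Nat.cast_pred hpos, ← Real.log_pow]
    exact Real.log_le_log (by positivity) two_pow_le
  have : (1 : ℝ) ≤ n.size := by exact_mod_cast hpos
  nlinarith [one_lt_log hn, Real.log_two_gt_d9]

theorem log_sq_le_rpow (hn : 3 ≤ n) :
    Real.log n ^ 2 ≤ (n : ℝ) ^ (4 / Real.log (Real.log n)) := by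
  have hlog := one_lt_log hn
  have hloglog : 0 < Real.log (Real.log n) := Real.log_pos hlog
  have loglog_sq_le : 2 * Real.log (Real.log n) ^ 2 ≤ 4 * Real.log n := by
    have := Real.quadratic_le_exp_of_nonneg hloglog.le
    rw [Real.exp_log (by positivity)] at this
    linarith
  rw [← Real.log_le_log_iff (by positivity) (Real.rpow_pos_of_pos (by positivity) _),
    Real.log_rpow (by positivity), Real.log_pow, div_mul_eq_mul_div, le_div_iff₀ hloglog]
  simpa [mul_assoc, sq] using loglog_sq_le

theorem log_sq_le_scale (n : ℕ) : Real.log n ^ 2 ≤ scale n :=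
  pow_le_pow_left₀ (Real.log_natCast_nonneg n) (log_le_size n) 2

theorem scale_le_nine_mul_log_sq (hn : 3 ≤ n) : scale n ≤ 9 * Real.log n ^ 2 :=
  (pow_le_pow_left₀ n.size.cast_nonneg (size_le_three_mul_log hn) 2).trans_eq (by ring)

theorem two_le_scale (hn : 2 ≤ n) : 2 ≤ scale n := by
  have : (2 : ℝ) ≤ n.size := by exact_mod_cast Nat.lt_size.mpr hn
  unfold scale
  nlinarith

theorem failure_le_one_div_pow {k : ℕ} (hn : 3 ≤ n) (hk : 4 * (k + 3) ≤ Real.log n) :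
    (n + 2) * (2 * Real.exp (-(scale n / 4))) ≤ 1 / (n : ℝ) ^ k := by
  have hn' : (3 : ℝ) ≤ n := by exact_mod_cast hn
  have log_le : Real.log ((n : ℝ) ^ (k + 3)) ≤ scale n / 4 := by
    rw [Real.log_pow]
    push_cast
    nlinarith [log_sq_le_scale n, one_lt_log hn]
  have linear_le_cube : (n + 2) * 2 ≤ (n : ℝ) ^ 3 := by
    nlinarith [mul_le_mul hn' hn' (by norm_num) (by positivity)]
  calc (n + 2) * (2 * Real.exp (-(scale n / 4)))
      ≤ (n + 2) * (2 * Real.exp (-Real.log ((n : ℝ) ^ (k + 3)))) := by gcongr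
    _ = (n + 2) * 2 * ((n : ℝ) ^ (k + 3))⁻¹ := by
        rw [Real.exp_neg, Real.exp_log (by positivity), mul_assoc]
    _ ≤ (n : ℝ) ^ 3 * ((n : ℝ) ^ (k + 3))⁻¹ := by gcongr
    _ = 1 / (n : ℝ) ^ k := by
        rw [pow_add]
        field_simp

end Logarithm

theorem measure_allocates_lt_envy_le {n k : ℕ} (hn : 3 ≤ n) (D : Fin 2 → Measure ℝ)
    {ν : Measure (Fin n → Fin 2 → ℝ)} [IsProbabilityMeasure ν]
    (hν : ∀ᵐ v ∂ν, ∀ j p, v j p ∈ Set.Icc (0 : ℝ) 1) {C : ℝ} (hC : 9 ≤ C)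
    (hCk : Real.exp (4 * (k + 3)) ≤ C) :
    (ν.prod uniformDraws) {x | ∃ S t, balancing.Allocates D x.2 x.1 S t ∧
      C * Real.log n ^ 2 < envy x.1 S} ≤ ENNReal.ofReal (1 / (n : ℝ) ^ k) := by
  obtain hk | hk := le_or_gt (4 * ((k : ℝ) + 3)) (Real.log n)
  · have scale_le : scale n ≤ C * Real.log n ^ 2 :=
      (scale_le_nine_mul_log_sq hn).trans (by gcongr)
    calc (ν.prod uniformDraws) {x | ∃ S t, balancing.Allocates D x.2 x.1 S t ∧
            C * Real.log n ^ 2 < envy x.1 S}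
        ≤ (ν.prod uniformDraws) {x | ∃ p : Fin 2, scale n <
            |⟪walk (scale n) (increments x.1) x.2 n, EuclideanSpace.single p 1⟫|} :=
          measure_mono fun _ ⟨_, _, hS, hlt⟩ => hS.exists_lt_abs_inner_walk (scale_le.trans_lt hlt)
      _ ≤ (n + 2) * (2 * ENNReal.ofReal (Real.exp (-(scale n / 4)))) :=
          measure_exists_lt_abs_inner_walk_increments_le hν (two_le_scale (by omega))
      _ = ENNReal.ofReal ((n + 2) * (2 * Real.exp (-(scale n / 4)))) := by
          simp [ENNReal.ofReal_mul, ENNReal.ofReal_add, add_nonneg]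
      _ ≤ _ := ENNReal.ofReal_le_ofReal (failure_le_one_div_pow hn hk)
  · have card_le : (n : ℝ) ≤ C * Real.log n ^ 2 := by
      have : (n : ℝ) ≤ C := ((Real.log_lt_iff_lt_exp (by positivity)).mp hk).le.trans hCk
      exact this.trans (le_mul_of_one_le_right (by positivity) (one_le_pow₀ (one_lt_log hn).le))
    calc (ν.prod uniformDraws) {x | ∃ S t, balancing.Allocates D x.2 x.1 S t ∧
            C * Real.log n ^ 2 < envy x.1 S}
        ≤ (ν.prod uniformDraws) {x | ∃ S, (n : ℝ) < envy x.1 S} :=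
          measure_mono fun x ⟨S, _, _, hlt⟩ => ⟨S, card_le.trans_lt hlt⟩
      _ = 0 := measure_card_lt_envy hν
      _ ≤ _ := zero_le

end OnlineEnvy

theorem theorem3_general :
    ∃ A : OnlineEnvy.Algorithm,
      (∀ (n : ℕ) (D : Fin 2 → Measure ℝ) (v : Fin n → Fin 2 → ℝ) (ω : ℕ → unitInterval),
        ∃ S t, A.Allocates D ω v S t ∧ t ≤ 8 * n + 3) ∧
      ∀ k : ℕ, ∃ C : ℝ, 0 ≤ C ∧ ∀ n : ℕ, 3 ≤ n → ∀ (D : Fin 2 → Measure ℝ)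
        (ν : Measure (Fin n → Fin 2 → ℝ)) [IsProbabilityMeasure ν],
        (∀ᵐ v ∂ν, ∀ j p, v j p ∈ Set.Icc (0 : ℝ) 1) →
        (ν.prod SelfBalancing.uniformDraws) {x | ∃ S t, A.Allocates D x.2 x.1 S t ∧
          C * Real.log n ^ 2 < OnlineEnvy.envy x.1 S} ≤ ENNReal.ofReal (1 / (n : ℝ) ^ k) :=
  ⟨OnlineEnvy.balancing, fun _ D v ω => OnlineEnvy.exists_allocates D ω v, fun k =>
    ⟨max 9 (Real.exp (4 * (k + 3))), by positivity, fun _ hn D _ _ hν =>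
      OnlineEnvy.measure_allocates_lt_envy_le hn D hν (le_max_left _ _) (le_max_right _ _)⟩⟩

theorem theorem3 :
    ∃ A : OnlineEnvy.Algorithm,
      (∃ p : Polynomial ℕ, ∀ (n : ℕ) (D : Fin 2 → MeasureTheory.Measure ℝ)
        (_ : ∀ i, MeasureTheory.IsProbabilityMeasure (D i)) (_ : ∀ i, D i (Set.Icc 0 1) = 1)
        (v : Fin n → Fin 2 → ℝ) (ω : ℕ → unitInterval),
        ∃ (S : Finset (Fin n)) (t : ℕ), A.Allocates D ω v S t ∧ t ≤ p.eval n) ∧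
      ∀ k : ℕ, ∃ c C : ℝ, ∀ n : ℕ, 3 ≤ n → ∀ (D : Fin 2 → MeasureTheory.Measure ℝ)
        (_ : ∀ i, MeasureTheory.IsProbabilityMeasure (D i)) (_ : ∀ i, D i (Set.Icc 0 1) = 1),
        OnlineEnvy.law D n
          {x | ∃ (S : Finset (Fin n)) (t : ℕ), A.Allocates D x.2 x.1 S t ∧
            C * (n : ℝ) ^ (c / Real.log (Real.log n)) < OnlineEnvy.envy x.1 S} ≤
          ENNReal.ofReal (1 / (n : ℝ) ^ k) := by
  obtain ⟨A, hsteps, henvy⟩ := theorem3_general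
  refine ⟨A, ⟨8 * .X + 3, fun n D _ _ v ω => by simpa using hsteps n D v ω⟩, fun k => ?_⟩
  obtain ⟨C, hC₀, hC⟩ := henvy k
  refine ⟨4, C, fun n hn D _ hD => (measure_mono ?_).trans
    (hC n hn D _ (OnlineEnvy.ae_mem_Icc D hD n))⟩
  rintro x ⟨S, t, hA, hlt⟩
  exact ⟨S, t, hA, (mul_le_mul_of_nonneg_left (OnlineEnvy.log_sq_le_rpow hn) hC₀).trans_lt hlt⟩
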